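/- Let $\mathbf k$ be a commutative ring with unit and let $K$ be a simplicial complex on $[m]=\{1,\dots,m\}$ (a family of subsets of $[m]$ closed under passing to subsets). For $I\subset[m]$ let $K_I=\{\sigma\in K:\sigma\subset I\}$, let $C^n(K_I)$, $n\ge -1$, be its augmented simplicial cochains over $\mathbf k$, and let $\tilde H^n(K_I)$ be its reduced simplicial cohomology. Consider the differential graded algebra $A=\bigoplus_{I\subset[m]}C^*(K_I)$, whose cohomology is $H^*(\mathcal Z_K;\mathbf k)\cong\bigoplus_I\tilde H^*(K_I)$ for the moment-angle complex $\mathcal Z_K$: elements of $C^n(K_I)$ have total degree $n+|I|+1$, the differential is the simplicial coboundary, and the product $C^p(K_I)\otimes C^q(K_J)\to C^{p+q+1}(K_{I\sqcup J})$ is, for $I\cap J=\varnothing$, the join of cochains restricted to $K_{I\sqcup J}\subset K_I*K_J$ (multiplied by a sign that depends only on $I$, $J$, $q$ and makes the Leibniz rule hold), and is $0$ if $I\cap J\ne\varnothing$. Explicitly, the sign is such that sending the cochain dual to the simplex $\sigma$ of $K_I$ to $(-1)^{\#\{(i,s)\in I\times\sigma\,:\,i<s\}}u_{I\setminus\sigma}v_\sigma$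 identifies $A$ with $\mathbf k[K]\otimes\Lambda[u_1,\dots,u_m]/(v_i^2=u_iv_i=0)$, $du_i=v_i$, $dv_i=0$. For $x$ of total degree $p$ put $\bar x=(-1)^{p+1}x$. Let $k\ge 3$, let $I_1,\dots,I_k\subset[m]$ be pairwise disjoint, let $d(1),\dots,d(k)\ge 0$, and let $\alpha_j\in\tilde H^{d(j)}(K_{I_j})$. For $1\le s\le t\le k$ put $d(s,t)=d(s)+\dots+d(t)+1$. A defining system for $\langle\alpha_1,\dots,\alpha_k\rangle$ is a family $C=(c_{i,j})$, $1\le i<j\le k+1$, $(i,j)\ne(1,k+1)$, of elements of $A$ such that $c_{i,i+1}\in C^{d(i)}(K_{I_i})$ is a cocycle representing $\alpha_i$, the entry $c_{s,t+1}$ is homogeneous of total degree $1+\sum_{r=s}^t(d(r)+|I_r|)$, and $$d\,c_{i,j}=\sum_{i<p<j}\bar c_{i,p}\,c_{p,j}\qquad\text{for all }(i,j)\neq(1,k+1).$$ It is multigraded if $c_{s,t+1}\in C^{d(s,t)-1}(K_{I_s\sqcup\dots\sqcup I_t})$ for all $s\le t$ with $(s,t)\ne(1,k)$. Put $a(C)=-\sum_{j=1}^{k-1}\bar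 c_{1,1+j}\,c_{1+j,k+1}$. The (multigraded) Massey product is the set $$\langle\alpha_1,\dots,\alpha_k\rangle=\{[a(C)]:C\text{ a multigraded defining system}\}\subset\tilde H^{d(1,k)}(K_{I_1\sqcup\dots\sqcup I_k})\subset H^*(\mathcal Z_K;\mathbf k).$$ It is defined if a multigraded defining system exists, and strictly defined if it is defined and consists of a single class. Then: (1) If $\tilde H^{d(s,r+s)}(K_{I_s\sqcup\dots\sqcup I_{r+s}})=0$ for all $1\le r\le k-2$ and $1\le s\le k-r$, then the $k$-fold Massey product $\langle\alpha_1,\dots,\alpha_k\rangle$ is defined. (2) If $\tilde H^{d(s,r+s)-1}(K_{I_s\sqcup\dots\sqcup I_{r+s}})=0$ for all $1\le r\le k-2$ and $1\le s\le k-r$, and $\langle\alpha_1,\dots,\alpha_k\rangle$ is defined, then it is strictly defined. (3) In the situation of (2) there is a defining system $C$ for $\langle\alpha_1,\dots,\alpha_k\rangle$ with $c_{s,r+s+1}\in C^{d(s,r+s)-1}(K_{I_s\sqcup\dots\sqcup I_{r+s}})$ for all $1\le r\le k-2$, $1\le s\le k-r$, such that $a(C)$ is a cocycle in $C^{d(1,k)}(K_{I_1\sqcup\dots\sqcup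 I_k})$ and $$\langle\alpha_1,\dots,\alpha_k\rangle=\{[a(C)]\}\subset\tilde H^{d(1,k)}(K_{I_1\sqcup\dots\sqcup I_k}).$$ -/

import Mathlib

/-! Massey products in the multigraded cochain algebra `⨁_{I ⊆ [m]} C^*(K_I)` of the
moment-angle complex of a simplicial complex `K` on the vertex set `[m]`, modelled by `Fin m`.
A simplicial complex is a family of subsets of `[m]` closed under passing to subsets, that is,
a `LowerSet (Finset (Fin m))`; ghost vertices are allowed. -/

namespace MomentAngle

variable {m : ℕ}

/-- A pair `(I, σ)` with `σ` a simplex (possibly empty) of the induced subcomplex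
`K_I = {σ ∈ K | σ ⊆ I}`. -/
abbrev Cell (K : LowerSet (Finset (Fin m))) : Type :=
  {p : Finset (Fin m) × Finset (Fin m) // p.2 ∈ K ∧ p.2 ⊆ p.1}

/-- The underlying module of `⨁_{I ⊆ [m]} C^*(K_I; 𝕜)`: as there are finitely many pairs
`(I, σ)`, an element is a function on them. The restriction of `x` to the pairs `(I, σ)` with `I`
fixed is the component of `x` in the augmented simplicial cochains of `K_I`. -/
abbrev CochainAlg (𝕜 : Type*) (K : LowerSet (Finset (Fin m))) : Type _ := Cell K → 𝕜

/-- The number of pairs `(a, b)` in `A × B` with `b < a`. -/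
def inversions (A B : Finset (Fin m)) : ℕ :=
  ((A ×ˢ B).filter (fun p => p.2 < p.1)).card

/-- The pair `(I, τ \ {v})`. -/
def Cell.erase {K : LowerSet (Finset (Fin m))} (p : Cell K) (v : Fin m) : Cell K :=
  ⟨(p.1.1, p.1.2.erase v),
    K.lower (Finset.erase_subset v p.1.2) p.2.1,
    (Finset.erase_subset v p.1.2).trans p.2.2⟩

/-- For the pair `(U, τ)` and a set `I`, the pair `(I, τ ∩ I)`. -/
def Cell.inside {K : LowerSet (Finset (Fin m))} (p : Cell K) (I : Finset (Fin m)) : Cell K :=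
  ⟨(I, p.1.2 ∩ I), K.lower Finset.inter_subset_left p.2.1, Finset.inter_subset_right⟩

/-- For the pair `(U, τ)` and a set `I`, the pair `(U \ I, τ \ I)`. -/
def Cell.outside {K : LowerSet (Finset (Fin m))} (p : Cell K) (I : Finset (Fin m)) : Cell K :=
  ⟨(p.1.1 \ I, p.1.2 \ I), K.lower Finset.sdiff_subset p.2.1,
    Finset.sdiff_subset_sdiff p.2.2 (Finset.Subset.refl I)⟩

variable (𝕜 : Type*) [CommRing 𝕜] (K : LowerSet (Finset (Fin m)))

/-- The differential: on each summand `C^*(K_I)` it is the simplicial coboundary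
`(dx)(τ) = ∑_{v ∈ τ} (-1)^{#{u ∈ τ | u < v}} x(τ \ {v})`. -/
def diff : CochainAlg 𝕜 K →ₗ[𝕜] CochainAlg 𝕜 K where
  toFun x p := ∑ v ∈ p.1.2, (-1 : 𝕜) ^ (p.1.2.filter (fun u => u < v)).card * x (p.erase v)
  map_add' x y := by
    funext p
    simp [mul_add, Finset.sum_add_distrib]
  map_smul' a x := by
    funext p
    simp [Finset.mul_sum, mul_left_comm]

variable {𝕜 K}

/-- The product. For `I ∩ J = ∅` it sends `C^*(K_I) ⊗ C^*(K_J)` to `C^*(K_{I ⊔ J})`, and is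
the restriction to `K_{I ⊔ J} ⊆ K_I * K_J` of the join of cochains, whose value on
`σ ⊔ ρ` is `(-1)^{inversions σ ρ} x(σ) y(ρ)`, multiplied by the sign
`(-1)^{|I| |ρ| + inversions I J}`, which depends only on `I`, `J` and the degree; this sign makes
the Leibniz rule hold for the total degree `|I| + |σ|`. For `I ∩ J ≠ ∅` the product is zero.
When the cochain dual to the simplex `σ` of `K_I` is sent to
`(-1)^{#{(i, s) ∈ I × σ | i < s}} u_{I \ σ} v_σ`, this product and the differential `diff` become
those of `𝕜[K] ⊗ Λ[u_1, …, u_m] / (v_i² = u_i v_i = 0)` with `d u_i = v_i`. -/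
def wedge (x y : CochainAlg 𝕜 K) : CochainAlg 𝕜 K := fun p =>
  ∑ I ∈ p.1.1.powerset,
    (-1 : 𝕜) ^ (I.card * (p.1.2 \ I).card + inversions I (p.1.1 \ I)
        + inversions (p.1.2 ∩ I) (p.1.2 \ I))
      * (x (p.inside I) * y (p.outside I))

/-- The involution `x ↦ x̄`, equal to `(-1)^{p + 1} x` for `x` of total degree `p`. -/
def bar (x : CochainAlg 𝕜 K) : CochainAlg 𝕜 K := fun p =>
  (-1 : 𝕜) ^ (p.1.1.card + p.1.2.card + 1) * x p

variable (𝕜 K)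

/-- The elements of total degree `q`; the cochains in `C^n(K_I)` have total degree
`n + |I| + 1`. -/
def homogeneous (q : ℤ) : Submodule 𝕜 (CochainAlg 𝕜 K) where
  carrier := {x | ∀ p : Cell K, x p ≠ 0 → ((p.1.1.card + p.1.2.card : ℕ) : ℤ) = q}
  zero_mem' := fun p hp => absurd rfl hp
  add_mem' := by
    intro x y hx hy p hp
    by_cases h : x p = 0
    · exact hy p (fun h' => hp (by simp [h, h']))
    · exact hx p h
  smul_mem' := by
    intro a x hx p hp
    exact hx p (fun h => hp (by simp [h]))

/-- The summand `C^n(K_I)` of augmented simplicial `n`-cochains of `K_I`: an `n`-simplex has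
`n + 1` vertices, and the empty simplex has dimension `-1`. -/
def cochains (I : Finset (Fin m)) (n : ℤ) : Submodule 𝕜 (CochainAlg 𝕜 K) where
  carrier := {x | ∀ p : Cell K, x p ≠ 0 → p.1.1 = I ∧ (p.1.2.card : ℤ) = n + 1}
  zero_mem' := fun p hp => absurd rfl hp
  add_mem' := by
    intro x y hx hy p hp
    by_cases h : x p = 0
    · exact hy p (fun h' => hp (by simp [h, h']))
    · exact hx p h
  smul_mem' := by
    intro a x hx p hp
    exact hx p (fun h => hp (by simp [h]))

/-- The `n`-cocycles of `K_I`. -/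
def cocycles (I : Finset (Fin m)) (n : ℤ) : Submodule 𝕜 (CochainAlg 𝕜 K) :=
  cochains 𝕜 K I n ⊓ LinearMap.ker (diff 𝕜 K)

/-- The `n`-coboundaries of `K_I`. -/
def coboundaries (I : Finset (Fin m)) (n : ℤ) : Submodule 𝕜 (CochainAlg 𝕜 K) :=
  (cochains 𝕜 K I (n - 1)).map (diff 𝕜 K)

/-- The reduced simplicial cohomology group `H̃^n(K_I; 𝕜)`. -/
abbrev RedCohomology (I : Finset (Fin m)) (n : ℤ) : Type _ :=
  cocycles 𝕜 K I n ⧸ (coboundaries 𝕜 K I n).comap (cocycles 𝕜 K I n).subtype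

variable {𝕜 K}

/-- The cochain `x` is an `n`-cocycle of `K_I` and its class is `α`. -/
def Represents {I : Finset (Fin m)} {n : ℤ} (x : CochainAlg 𝕜 K)
    (α : RedCohomology 𝕜 K I n) : Prop :=
  ∃ h : x ∈ cocycles 𝕜 K I n, Submodule.Quotient.mk ⟨x, h⟩ = α

/-- The vertex set `I_s ∪ ⋯ ∪ I_t`. -/
def block (I : ℕ → Finset (Fin m)) (s t : ℕ) : Finset (Fin m) :=
  (Finset.Icc s t).biUnion I

/-- The number `d(s, t) = d(s) + ⋯ + d(t) + 1`. -/
def blockDeg (d : ℕ → ℤ) (s t : ℕ) : ℤ :=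
  ∑ j ∈ Finset.Icc s t, d j + 1

variable {I : ℕ → Finset (Fin m)} {d : ℕ → ℤ}

/-- A defining system `C = (c_{i,j})_{1 ≤ i < j ≤ k + 1, (i,j) ≠ (1,k+1)}` for
`⟨α_1, …, α_k⟩` in the differential graded algebra `⨁_{I ⊆ [m]} C^*(K_I)`: the entry
`c_{i,i+1}` represents `α_i`, of total degree `p_i = d(i) + |I_i| + 1`; the entry `c_{s,t+1}` has
total degree `1 + ∑_{r=s}^t (p_r - 1)`; and `d c_{i,j} = ∑_{i<p<j} c̄_{i,p} ∧ c_{p,j}`.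
All other values of `c` are irrelevant. -/
structure IsDefiningSystem (k : ℕ) (α : ∀ j, RedCohomology 𝕜 K (I j) (d j))
    (c : ℕ → ℕ → CochainAlg 𝕜 K) : Prop where
  represents : ∀ i, 1 ≤ i → i ≤ k → Represents (c i (i + 1)) (α i)
  degree : ∀ s t, 1 ≤ s → s ≤ t → t ≤ k → (s, t) ≠ (1, k) →
    c s (t + 1) ∈ homogeneous 𝕜 K
      (1 + ∑ r ∈ Finset.Icc s t, ((d r + ((I r).card : ℤ) + 1) - 1))
  diff_eq : ∀ i j, 1 ≤ i → i < j → j ≤ k + 1 → (i, j) ≠ (1, k + 1) →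
    diff 𝕜 K (c i j) = ∑ p ∈ Finset.Ioo i j, wedge (bar (c i p)) (c p j)

/-- A multigraded defining system: the entry `c_{s,t+1}` is a simplicial cochain on the induced
subcomplex on `I_s ∪ ⋯ ∪ I_t`, of dimension `d(s, t) - 1`. -/
structure IsMultigradedDefiningSystem (k : ℕ) (α : ∀ j, RedCohomology 𝕜 K (I j) (d j))
    (c : ℕ → ℕ → CochainAlg 𝕜 K) : Prop extends IsDefiningSystem k α c where
  mem_cochains : ∀ s t, 1 ≤ s → s ≤ t → t ≤ k → (s, t) ≠ (1, k) →
    c s (t + 1) ∈ cochains 𝕜 K (block I s t) (blockDeg d s t - 1)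

/-- The related cocycle `a(C) = -∑_{j=1}^{k-1} c̄_{1,1+j} ∧ c_{1+j,k+1}`. -/
def relatedCochain (k : ℕ) (c : ℕ → ℕ → CochainAlg 𝕜 K) : CochainAlg 𝕜 K :=
  -∑ j ∈ Finset.Icc 1 (k - 1), wedge (bar (c 1 (1 + j))) (c (1 + j) (k + 1))

/-- The Massey product `⟨α_1, …, α_k⟩` is defined. -/
def MasseyDefined (k : ℕ) (α : ∀ j, RedCohomology 𝕜 K (I j) (d j)) : Prop :=
  ∃ c : ℕ → ℕ → CochainAlg 𝕜 K, IsMultigradedDefiningSystem k α c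

/-- The Massey product `⟨α_1, …, α_k⟩ ⊆ H̃^{d(1,k)}(K_{I_1 ∪ ⋯ ∪ I_k})`: the set of the classes
`[a(C)]` of all multigraded defining systems `C`. -/
def masseyProduct (k : ℕ) (α : ∀ j, RedCohomology 𝕜 K (I j) (d j)) :
    Set (RedCohomology 𝕜 K (block I 1 k) (blockDeg d 1 k)) :=
  {x | ∃ c : ℕ → ℕ → CochainAlg 𝕜 K,
    IsMultigradedDefiningSystem k α c ∧ Represents (relatedCochain k c) x}

/-- The Massey product `⟨α_1, …, α_k⟩` is defined and consists of a single class. -/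
def MasseyStrictlyDefined (k : ℕ) (α : ∀ j, RedCohomology 𝕜 K (I j) (d j)) : Prop :=
  MasseyDefined k α ∧ ∃ x, masseyProduct k α = {x}

end MomentAngle

namespace MomentAngle

/-! ### Signs and the differential graded algebra structure. -/

section Algebra

variable {𝕜 : Type*} [CommRing 𝕜] {m : ℕ} {K : LowerSet (Finset (Fin m))}

/-! Regard a defining system as a strictly upper triangular matrix `c` over the cochain algebra. It
satisfies the Maurer-Cartan equation dc = c̄c at every entry except the corner (1, k+1), and a(C) is
the corner entry of -c̄c. All computations use associativity and three sign rules: d(xy) = (dx)y -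
x̄(dy), and bar anticommutes with d and satisfies bar(xy) = -x̄ȳ.

Existence: if the equation holds on all shorter intervals, then d(c̄c) = (cc̄)c - c(c̄c) = 0 at the
current entry (`diff_conv_bar_eq_zero`). The right-hand side is thus a cocycle on the block I_s ∪ ⋯
∪ I_t in degree d(s,t). If that cohomology vanishes, a primitive exists, and the matrix is filled by
recursion on interval length (`exists_family`).

Uniqueness: for two systems c and c', look for a matrix b with db = c' - c + cb + b̄c'. Formally
this is the gauge equation dg = cg + ḡc' for g = b - 1, since the bar of 1 is -1. On single blocks,
c' - c is exact because both entries represent the same class. On longer blocks the right-hand side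
is a cocycle of degree d(s,t) - 1 (`diff_gauge`), so vanishing cohomology supplies b. At the corner,
cb + b̄c' has coboundary c̄c - c̄'c' = a(C') - a(C), so the class is independent of the system. -/

lemma inversions_union_left {A B : Finset (Fin m)} (C : Finset (Fin m)) (h : Disjoint A B) :
    inversions (A ∪ B) C = inversions A C + inversions B C := by
  unfold inversions
  rw [Finset.union_product, Finset.filter_union, Finset.card_union_of_disjoint]
  exact Finset.disjoint_filter_filter (Finset.disjoint_product.2 (Or.inl h))

lemma inversions_union_right {B C : Finset (Fin m)} (A : Finset (Fin m)) (h : Disjoint B C) :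
    inversions A (B ∪ C) = inversions A B + inversions A C := by
  unfold inversions
  rw [Finset.product_union, Finset.filter_union, Finset.card_union_of_disjoint]
  exact Finset.disjoint_filter_filter (Finset.disjoint_product.2 (Or.inr h))

lemma inversions_singleton_left (v : Fin m) (B : Finset (Fin m)) :
    inversions {v} B = (B.filter (fun u => u < v)).card := by
  unfold inversions
  rw [Finset.singleton_product, Finset.filter_map, Finset.card_map]
  rfl

lemma inversions_singleton_right (A : Finset (Fin m)) (v : Fin m) :
    inversions A {v} = (A.filter (fun u => v < u)).card := by
  unfold inversions
  rw [Finset.product_singleton, Finset.filter_map, Finset.card_map]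
  rfl

lemma inversions_erase_left {A : Finset (Fin m)} (B : Finset (Fin m)) {v : Fin m} (hv : v ∈ A) :
    inversions A B = inversions (A.erase v) B + (B.filter (fun u => u < v)).card := by
  conv_lhs => rw [← Finset.insert_erase hv, Finset.insert_eq, Finset.union_comm]
  rw [inversions_union_left _ (by simp), inversions_singleton_left]

lemma inversions_erase_right (A : Finset (Fin m)) {B : Finset (Fin m)} {v : Fin m} (hv : v ∈ B) :
    inversions A B = inversions A (B.erase v) + (A.filter (fun u => v < u)).card := by
  conv_lhs => rw [← Finset.insert_erase hv, Finset.insert_eq, Finset.union_comm]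
  rw [inversions_union_right _ (by simp), inversions_singleton_right]

/-- The exponent of the sign in `wedge`. -/
def wedgeExp (p : Cell K) (I : Finset (Fin m)) : ℕ :=
  I.card * (p.1.2 \ I).card + inversions I (p.1.1 \ I) + inversions (p.1.2 ∩ I) (p.1.2 \ I)

lemma wedge_apply (x y : CochainAlg 𝕜 K) (p : Cell K) :
    wedge x y p =
      ∑ I ∈ p.1.1.powerset, (-1 : 𝕜) ^ wedgeExp p I * (x (p.inside I) * y (p.outside I)) := rfl

lemma diff_apply (x : CochainAlg 𝕜 K) (p : Cell K) :
    diff 𝕜 K x p =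
      ∑ v ∈ p.1.2, (-1 : 𝕜) ^ (p.1.2.filter (fun u => u < v)).card * x (p.erase v) := rfl

variable (𝕜 K) in
/-- The product `wedge` as a bilinear map. -/
def wedgeLin : CochainAlg 𝕜 K →ₗ[𝕜] CochainAlg 𝕜 K →ₗ[𝕜] CochainAlg 𝕜 K :=
  LinearMap.mk₂ 𝕜 wedge
    (fun x x' y => by
      funext p; simp [wedge_apply, add_mul, mul_add, Finset.sum_add_distrib])
    (fun a x y => by
      funext p
      simp only [wedge_apply, Pi.smul_apply, smul_eq_mul, Finset.mul_sum]
      exact Finset.sum_congr rfl fun I _ => by ring)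
    (fun x y y' => by
      funext p; simp [wedge_apply, mul_add, Finset.sum_add_distrib])
    (fun a x y => by
      funext p
      simp only [wedge_apply, Pi.smul_apply, smul_eq_mul, Finset.mul_sum]
      exact Finset.sum_congr rfl fun I _ => by ring)

lemma wedgeLin_apply (x y : CochainAlg 𝕜 K) : wedgeLin 𝕜 K x y = wedge x y := rfl

variable (𝕜 K) in
/-- The involution `bar` as a linear map. -/
def barLin : CochainAlg 𝕜 K →ₗ[𝕜] CochainAlg 𝕜 K where
  toFun := bar
  map_add' x y := by funext p; simp [bar, mul_add]
  map_smul' a x := by funext p; simp only [bar, Pi.smul_apply, smul_eq_mul, RingHom.id_apply]; ring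

lemma neg_one_pow_congr {a b : ℕ} (h : Even (a + b)) : (-1 : 𝕜) ^ a = (-1 : 𝕜) ^ b := by
  have h1 : (-1 : 𝕜) ^ (a + b) = 1 := h.neg_one_pow
  have h2 : (-1 : 𝕜) ^ b * (-1 : 𝕜) ^ b = 1 := by rw [← pow_add, (Even.add_self b).neg_one_pow]
  calc (-1 : 𝕜) ^ a = (-1 : 𝕜) ^ a * ((-1 : 𝕜) ^ b * (-1 : 𝕜) ^ b) := by rw [h2, mul_one]
    _ = (-1 : 𝕜) ^ b := by rw [← mul_assoc, ← pow_add, h1, one_mul]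

lemma bar_bar (x : CochainAlg 𝕜 K) : bar (bar x) = x := by
  funext p
  simp only [bar]
  rw [← mul_assoc, ← pow_add, (Even.add_self _).neg_one_pow, one_mul]

/-- The differential raises the total degree by one, which flips the sign in `bar`. -/
lemma bar_diff (x : CochainAlg 𝕜 K) : bar (diff 𝕜 K x) = -diff 𝕜 K (bar x) := by
  funext p
  simp only [bar, Pi.neg_apply, diff_apply, Finset.mul_sum, ← Finset.sum_neg_distrib]
  refine Finset.sum_congr rfl fun v hv => ?_
  have h : p.1.2.card = (p.erase v).1.2.card + 1 := (Finset.card_erase_add_one hv).symm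
  have h' : (p.erase v).1.1 = p.1.1 := rfl
  rw [h, h']
  ring

/-- Total degrees add, but the shift by one in the exponent of `bar` occurs once on the left and
twice on the right. -/
lemma bar_wedge (x y : CochainAlg 𝕜 K) : bar (wedge x y) = -wedge (bar x) (bar y) := by
  funext p
  simp only [bar, Pi.neg_apply, wedge_apply, Finset.mul_sum, ← Finset.sum_neg_distrib]
  refine Finset.sum_congr rfl fun I hI => ?_
  have h1 : p.1.1.card = (p.outside I).1.1.card + (p.inside I).1.1.card :=
    (Finset.card_sdiff_add_card_eq_card (Finset.mem_powerset.1 hI)).symm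
  have h2 : p.1.2.card = (p.inside I).1.2.card + (p.outside I).1.2.card :=
    (Finset.card_inter_add_card_sdiff p.1.2 I).symm
  rw [h1, h2]
  ring

lemma erase_inside_comm (p : Cell K) {I : Finset (Fin m)} {v : Fin m} :
    (p.erase v).inside I = (p.inside I).erase v :=
  Subtype.ext (Prod.ext rfl (Finset.erase_inter v p.1.2 I))

lemma erase_outside_of_mem (p : Cell K) {I : Finset (Fin m)} {v : Fin m} (hv : v ∈ I) :
    (p.erase v).outside I = p.outside I := by
  refine Subtype.ext (Prod.ext rfl ?_)
  show p.1.2.erase v \ I = p.1.2 \ I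
  ext a; simp only [Finset.mem_sdiff, Finset.mem_erase]; grind

lemma erase_inside_of_notMem (p : Cell K) {I : Finset (Fin m)} {v : Fin m} (hv : v ∉ I) :
    (p.erase v).inside I = p.inside I := by
  refine Subtype.ext (Prod.ext rfl ?_)
  show p.1.2.erase v ∩ I = p.1.2 ∩ I
  ext a; simp only [Finset.mem_inter, Finset.mem_erase]; grind

lemma erase_outside_comm (p : Cell K) {I : Finset (Fin m)} {v : Fin m} :
    (p.erase v).outside I = (p.outside I).erase v :=
  Subtype.ext (Prod.ext rfl (Finset.erase_sdiff_comm p.1.2 I v))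

lemma card_filter_lt_split (τ I : Finset (Fin m)) (v : Fin m) :
    (τ.filter (fun u => u < v)).card =
      ((τ ∩ I).filter (fun u => u < v)).card + ((τ \ I).filter (fun u => u < v)).card := by
  rw [← Finset.card_inter_add_card_sdiff (τ.filter (fun u => u < v)) I]
  congr 2 <;> ext <;> simp <;> tauto

/-- The Leibniz rule. -/
lemma diff_wedge (x y : CochainAlg 𝕜 K) :
    diff 𝕜 K (wedge x y) = wedge (diff 𝕜 K x) y - wedge (bar x) (diff 𝕜 K y) := by
  funext p
  have hl : diff 𝕜 K (wedge x y) p = ∑ I ∈ p.1.1.powerset, ∑ v ∈ p.1.2,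
      (-1 : 𝕜) ^ (p.1.2.filter (fun u => u < v)).card * ((-1 : 𝕜) ^ wedgeExp (p.erase v) I *
        (x ((p.erase v).inside I) * y ((p.erase v).outside I))) := by
    rw [diff_apply, Finset.sum_comm]
    refine Finset.sum_congr rfl fun v _ => ?_
    rw [wedge_apply, Finset.mul_sum]
    rfl
  rw [hl, Pi.sub_apply, wedge_apply, wedge_apply, ← Finset.sum_sub_distrib]
  -- The terms are compared for each splitting `I` separately: deleting a vertex of τ inside `I`
  -- gives the term with dx, deleting one outside gives the term with dy.
  refine Finset.sum_congr rfl fun I _ => ?_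
  have hsplit : p.1.2 = (p.1.2 ∩ I) ∪ (p.1.2 \ I) := by ext; simp; tauto
  rw [Finset.sum_congr hsplit (fun _ _ => rfl), Finset.sum_union
    (Finset.disjoint_left.2 fun a ha hb =>
      (Finset.mem_sdiff.1 hb).2 (Finset.mem_inter.1 ha).2), sub_eq_add_neg]
  congr 1
  · rw [diff_apply, Finset.sum_mul, Finset.mul_sum]
    refine Finset.sum_congr rfl fun v hv => ?_
    have hvI := (Finset.mem_inter.1 hv).2
    rw [erase_inside_comm, erase_outside_of_mem p hvI]
    have e1 : (p.1.2.erase v) \ I = p.1.2 \ I :=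
      congrArg (fun q : Cell K => q.1.2) (erase_outside_of_mem p hvI)
    have e2 : (p.1.2.erase v) ∩ I = (p.1.2 ∩ I).erase v := Finset.erase_inter v p.1.2 I
    have h1 := card_filter_lt_split p.1.2 I v
    have h2 : inversions (p.1.2 ∩ I) _ = inversions ((p.1.2 ∩ I).erase v) _ + _ :=
      inversions_erase_left (p.1.2 \ I) hv
    have key : (-1 : 𝕜) ^ ((p.1.2.filter (fun u => u < v)).card + wedgeExp (p.erase v) I) =
        (-1 : 𝕜) ^ (wedgeExp p I + ((p.inside I).1.2.filter (fun u => u < v)).card) := by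
      refine congrArg _ ?_
      simp only [wedgeExp, Cell.erase, Cell.inside, e1, e2]
      omega
    rw [← mul_assoc, ← pow_add, key, pow_add]
    ring
  · rw [diff_apply, Finset.mul_sum, Finset.mul_sum, ← Finset.sum_neg_distrib]
    refine Finset.sum_congr rfl fun v hv => ?_
    have hvI := (Finset.mem_sdiff.1 hv).2
    rw [erase_inside_of_notMem p hvI, erase_outside_comm]
    have e1 : (p.1.2.erase v) \ I = (p.1.2 \ I).erase v := Finset.erase_sdiff_comm p.1.2 I v
    have e2 : (p.1.2.erase v) ∩ I = p.1.2 ∩ I :=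
      congrArg (fun q : Cell K => q.1.2) (erase_inside_of_notMem p hvI)
    have h1 := card_filter_lt_split p.1.2 I v
    have h2 : inversions _ (p.1.2 \ I) = inversions _ ((p.1.2 \ I).erase v) + _ :=
      inversions_erase_right (p.1.2 ∩ I) hv
    have h3 : (p.1.2 ∩ I).card = ((p.1.2 ∩ I).filter (fun u => u < v)).card
        + ((p.1.2 ∩ I).filter (fun u => v < u)).card := by
      rw [← Finset.card_filter_add_card_filter_not (s := p.1.2 ∩ I) (fun u => u < v)]
      congr 2
      refine Finset.filter_congr fun u hu => ?_
      have : u ≠ v := fun h => hvI (h ▸ (Finset.mem_inter.1 hu).2)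
      rw [not_lt]
      exact ⟨fun h => lt_of_le_of_ne h this.symm, le_of_lt⟩
    have h4 : (p.1.2 \ I).card = ((p.1.2 \ I).erase v).card + 1 :=
      (Finset.card_erase_add_one hv).symm
    -- Removing v from ρ = τ \ I changes |I||ρ| by |I|. The vertices of σ = τ ∩ I below v and the
    -- inversions lost above v together contribute |σ|. This is the sign of `bar`; the two extra
    -- units are the shift in `bar` and the minus sign of the Leibniz rule.
    have key : (-1 : 𝕜) ^ ((p.1.2.filter (fun u => u < v)).card + wedgeExp (p.erase v) I) =
        (-1 : 𝕜) ^ (wedgeExp p I + ((p.inside I).1.1.card + (p.inside I).1.2.card + 1)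
          + ((p.outside I).1.2.filter (fun u => u < v)).card + 1) := by
      refine neg_one_pow_congr ?_
      simp only [wedgeExp, Cell.erase, Cell.inside, Cell.outside, e1, e2]
      rw [h1, h2, h3, h4, Nat.mul_succ]
      refine ⟨((p.1.2 ∩ I).filter (fun u => u < v)).card + ((p.1.2 \ I).filter (fun u => u < v)).card
        + I.card * ((p.1.2 \ I).erase v).card + inversions I (p.1.1 \ I) + I.card
        + inversions (p.1.2 ∩ I) ((p.1.2 \ I).erase v)
        + ((p.1.2 ∩ I).filter (fun u => v < u)).card + 1, ?_⟩
      ring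
    rw [← mul_assoc, ← pow_add, key, bar, pow_add, pow_add, pow_add]
    ring

/-- Both sides sum over ordered splittings of the vertex set into three parts, encoded as I ⊆ L on
the left and as (I, L \ I) on the right. The sign exponents agree as natural numbers, because
cardinality and `inversions` are additive over disjoint unions. -/
lemma wedge_assoc (x y z : CochainAlg 𝕜 K) :
    wedge (wedge x y) z = wedge x (wedge y z) := by
  funext p
  simp only [wedge_apply, Finset.mul_sum, Finset.sum_mul]
  rw [Finset.sum_sigma', Finset.sum_sigma']
  refine Finset.sum_bij' (fun a _ => ⟨a.2, a.1 \ a.2⟩) (fun a _ => ⟨a.1 ∪ a.2, a.1⟩)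
    ?_ ?_ ?_ ?_ ?_
  · rintro ⟨L, I⟩ h
    simp only [Finset.mem_sigma, Finset.mem_powerset] at h ⊢
    have h1 : L ⊆ p.1.1 := h.1
    have h2 : I ⊆ L := h.2
    exact ⟨h2.trans h1, Finset.sdiff_subset_sdiff h1 subset_rfl⟩
  · rintro ⟨I, J⟩ h
    simp only [Finset.mem_sigma, Finset.mem_powerset] at h ⊢
    have h1 : I ⊆ p.1.1 := h.1
    have h2 : J ⊆ p.1.1 \ I := h.2
    exact ⟨Finset.union_subset h1 (h2.trans Finset.sdiff_subset), Finset.subset_union_left⟩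
  · rintro ⟨L, I⟩ h
    have h2 : I ⊆ L := Finset.mem_powerset.1 (Finset.mem_sigma.1 h).2
    simp [Finset.union_eq_right.2 h2]
  · rintro ⟨I, J⟩ h
    have h2 : J ⊆ p.1.1 \ I := Finset.mem_powerset.1 (Finset.mem_sigma.1 h).2
    have : Disjoint J I := Finset.disjoint_of_subset_left h2 Finset.sdiff_disjoint
    simp [Finset.union_sdiff_cancel_left this.symm]
  · rintro ⟨L, I⟩ h
    have hL : L ⊆ p.1.1 := Finset.mem_powerset.1 (Finset.mem_sigma.1 h).1
    have hI : I ⊆ L := Finset.mem_powerset.1 (Finset.mem_sigma.1 h).2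
    have e1 : (p.inside L).inside I = p.inside I :=
      Subtype.ext (Prod.ext rfl (by simp only [Cell.inside]; clear h; grind))
    have e2 : (p.inside L).outside I =
        (p.outside I).inside (L \ I) :=
      Subtype.ext (Prod.ext rfl (by simp only [Cell.inside, Cell.outside]; grind))
    have e3 : p.outside L =
        (p.outside I).outside (L \ I) :=
      Subtype.ext (Prod.ext (by simp only [Cell.outside]; grind)
        (by simp only [Cell.outside]; grind))
    have key : wedgeExp p L + wedgeExp (p.inside L) I =
        wedgeExp p I
          + wedgeExp (p.outside I) (L \ I) := by
      obtain ⟨⟨U, τ⟩, hp⟩ := p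
      simp only [wedgeExp, Cell.inside, Cell.outside]
      replace hL : L ⊆ U := hL
      have a1 : (τ ∩ L) \ I = (τ \ I) ∩ (L \ I) := by grind
      have a2 : τ ∩ L ∩ I = τ ∩ I := by grind
      have a3 : (U \ I) \ (L \ I) = U \ L := by grind
      have a4 : (τ \ I) \ (L \ I) = τ \ L := by grind
      have a5 : U \ I = (L \ I) ∪ (U \ L) := by grind
      have a6 : τ \ I = ((τ \ I) ∩ (L \ I)) ∪ (τ \ L) := by grind
      have a7 : τ ∩ L = (τ ∩ I) ∪ ((τ \ I) ∩ (L \ I)) := by grind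
      have a8 : L.card = I.card + (L \ I).card := by
        rw [add_comm, Finset.card_sdiff_add_card_eq_card hI]
      have d5 : Disjoint (L \ I) (U \ L) := Finset.disjoint_left.2 (by grind)
      have d6 : Disjoint ((τ \ I) ∩ (L \ I)) (τ \ L) := Finset.disjoint_left.2 (by grind)
      have d7 : Disjoint (τ ∩ I) ((τ \ I) ∩ (L \ I)) := Finset.disjoint_left.2 (by grind)
      have b1 : (τ \ I).card = ((τ \ I) ∩ (L \ I)).card + (τ \ L).card := by
        conv_lhs => rw [a6]
        exact Finset.card_union_of_disjoint d6
      have b2 : inversions L (U \ L) = inversions I (U \ L) + inversions (L \ I) (U \ L) := by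
        rw [← inversions_union_left _ Finset.disjoint_sdiff, Finset.union_sdiff_of_subset hI]
      have b3 : inversions I (U \ I) = inversions I (L \ I) + inversions I (U \ L) := by
        rw [← inversions_union_right _ d5, ← a5]
      have b4 : inversions (τ ∩ L) (τ \ L) = inversions (τ ∩ I) (τ \ L)
          + inversions ((τ \ I) ∩ (L \ I)) (τ \ L) := by
        rw [← inversions_union_left _ d7, ← a7]
      have b5 : inversions (τ ∩ I) (τ \ I) = inversions (τ ∩ I) ((τ \ I) ∩ (L \ I))
          + inversions (τ ∩ I) (τ \ L) := by
        rw [← inversions_union_right _ d6, ← a6]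
      rw [a1, a2, a3, a4, b2, b3, b4, b5, b1, a8]
      ring
    have key' := congrArg (fun n => (-1 : 𝕜) ^ n) key
    simp only [pow_add] at key'
    simp only [e1, e2, ← e3]
    linear_combination (x (p.inside I) *
      y ((p.outside I).inside (L \ I)) *
      z (p.outside L)) * key'

/-- The shift by one arises because an n-simplex has n + 1 vertices and vertex counts add. -/
lemma wedge_mem_cochains {I J : Finset (Fin m)} {a b : ℤ} {x y : CochainAlg 𝕜 K}
    (hx : x ∈ cochains 𝕜 K I a) (hy : y ∈ cochains 𝕜 K J b) :
    wedge x y ∈ cochains 𝕜 K (I ∪ J) (a + b + 1) := by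
  intro p hp
  rw [wedge_apply] at hp
  obtain ⟨L, hL, hne⟩ := Finset.exists_ne_zero_of_sum_ne_zero hp
  have hL' := Finset.mem_powerset.1 hL
  obtain ⟨h1, h2⟩ := hx _ (fun h => hne (by rw [h]; ring) : x (p.inside L) ≠ 0)
  obtain ⟨h3, h4⟩ := hy _ (fun h => hne (by rw [h]; ring) : y (p.outside L) ≠ 0)
  have h1' : L = I := h1
  have h3' : p.1.1 \ L = J := h3
  have h2' : ((p.1.2 ∩ L).card : ℤ) = a + 1 := h2
  have h4' : ((p.1.2 \ L).card : ℤ) = b + 1 := h4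
  refine ⟨?_, ?_⟩
  · rw [← h3', ← h1', Finset.union_sdiff_of_subset hL']
  · rw [← Finset.card_inter_add_card_sdiff p.1.2 L]
    push_cast
    linarith

lemma bar_mem_cochains {I : Finset (Fin m)} {a : ℤ} {x : CochainAlg 𝕜 K}
    (hx : x ∈ cochains 𝕜 K I a) : bar x ∈ cochains 𝕜 K I a :=
  fun p hp => hx p fun h => hp (by simp [bar, h])

end Algebra

end MomentAngle

namespace MomentAngle

/-! ### Triangular matrices of cochains, Maurer-Cartan and gauge equations. -/

section Families

variable {𝕜 : Type*} [CommRing 𝕜] {m : ℕ} {K : LowerSet (Finset (Fin m))}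

lemma bar_add (x y : CochainAlg 𝕜 K) : bar (x + y) = bar x + bar y := (barLin 𝕜 K).map_add x y

lemma bar_sub (x y : CochainAlg 𝕜 K) : bar (x - y) = bar x - bar y := (barLin 𝕜 K).map_sub x y

lemma bar_sum {ι : Type*} (s : Finset ι) (f : ι → CochainAlg 𝕜 K) :
    bar (∑ i ∈ s, f i) = ∑ i ∈ s, bar (f i) := map_sum (barLin 𝕜 K) f s

lemma wedge_sum_left {ι : Type*} (s : Finset ι) (f : ι → CochainAlg 𝕜 K) (y : CochainAlg 𝕜 K) :
    wedge (∑ i ∈ s, f i) y = ∑ i ∈ s, wedge (f i) y := by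
  simp only [← wedgeLin_apply, map_sum, LinearMap.sum_apply]

lemma wedge_sum_right {ι : Type*} (s : Finset ι) (x : CochainAlg 𝕜 K) (f : ι → CochainAlg 𝕜 K) :
    wedge x (∑ i ∈ s, f i) = ∑ i ∈ s, wedge x (f i) := by
  simp only [← wedgeLin_apply, map_sum]

/-- The product of two strictly upper triangular matrices with entries in the cochain algebra. -/
def conv (f g : ℕ → ℕ → CochainAlg 𝕜 K) (i j : ℕ) : CochainAlg 𝕜 K :=
  ∑ p ∈ Finset.Ioo i j, wedge (f i p) (g p j)

/-- The entrywise involution of a family of cochains. -/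
def barFamily (f : ℕ → ℕ → CochainAlg 𝕜 K) (i j : ℕ) : CochainAlg 𝕜 K := bar (f i j)

/-- The entrywise differential of a family of cochains. -/
def diffFamily (f : ℕ → ℕ → CochainAlg 𝕜 K) (i j : ℕ) : CochainAlg 𝕜 K := diff 𝕜 K (f i j)

/-- An entry of the product involves only strictly shorter intervals. This locality allows equations
known only there to be substituted, and makes the recursions well-founded. -/
lemma conv_congr {f f' g g' : ℕ → ℕ → CochainAlg 𝕜 K} {i j : ℕ}
    (hf : ∀ p, i < p → p < j → f i p = f' i p) (hg : ∀ p, i < p → p < j → g p j = g' p j) :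
    conv f g i j = conv f' g' i j := by
  refine Finset.sum_congr rfl fun p hp => ?_
  obtain ⟨h1, h2⟩ := Finset.mem_Ioo.1 hp
  rw [hf p h1 h2, hg p h1 h2]

lemma conv_succ (f g : ℕ → ℕ → CochainAlg 𝕜 K) (i : ℕ) : conv f g i (i + 1) = 0 := by
  have : Finset.Ioo i (i + 1) = ∅ := by
    ext a
    simp only [Finset.mem_Ioo, Finset.notMem_empty, iff_false]
    omega
  rw [conv, this, Finset.sum_empty]

lemma conv_add_left (f f' g : ℕ → ℕ → CochainAlg 𝕜 K) : conv (f + f') g = conv f g + conv f' g := by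
  funext i j
  simp [conv, ← wedgeLin_apply, Finset.sum_add_distrib]

lemma conv_sub_left (f f' g : ℕ → ℕ → CochainAlg 𝕜 K) : conv (f - f') g = conv f g - conv f' g := by
  funext i j
  simp [conv, ← wedgeLin_apply, Finset.sum_sub_distrib]

lemma conv_add_right (f g g' : ℕ → ℕ → CochainAlg 𝕜 K) :
    conv f (g + g') = conv f g + conv f g' := by
  funext i j
  simp [conv, ← wedgeLin_apply, Finset.sum_add_distrib]

lemma conv_sub_right (f g g' : ℕ → ℕ → CochainAlg 𝕜 K) :
    conv f (g - g') = conv f g - conv f g' := by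
  funext i j
  simp [conv, ← wedgeLin_apply, Finset.sum_sub_distrib]

lemma conv_neg_left (f g : ℕ → ℕ → CochainAlg 𝕜 K) : conv (-f) g = -conv f g := by
  funext i j
  simp [conv, ← wedgeLin_apply]

lemma conv_assoc (f g h : ℕ → ℕ → CochainAlg 𝕜 K) :
    conv (conv f g) h = conv f (conv g h) := by
  funext i j
  simp only [conv, wedge_sum_left, wedge_sum_right, wedge_assoc]
  refine Finset.sum_comm' fun p q => ?_
  simp only [Finset.mem_Ioo]
  omega

lemma barFamily_barFamily (f : ℕ → ℕ → CochainAlg 𝕜 K) : barFamily (barFamily f) = f := by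
  funext i j
  exact bar_bar _

lemma barFamily_add (f g : ℕ → ℕ → CochainAlg 𝕜 K) :
    barFamily (f + g) = barFamily f + barFamily g := by
  funext i j
  exact bar_add _ _

lemma barFamily_sub (f g : ℕ → ℕ → CochainAlg 𝕜 K) :
    barFamily (f - g) = barFamily f - barFamily g := by
  funext i j
  exact bar_sub _ _

lemma barFamily_conv (f g : ℕ → ℕ → CochainAlg 𝕜 K) :
    barFamily (conv f g) = -conv (barFamily f) (barFamily g) := by
  funext i j
  simp only [barFamily, conv, bar_sum, bar_wedge, Pi.neg_apply, Finset.sum_neg_distrib]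

lemma diffFamily_barFamily (f : ℕ → ℕ → CochainAlg 𝕜 K) :
    diffFamily (barFamily f) = -barFamily (diffFamily f) := by
  funext i j
  simp only [Pi.neg_apply, barFamily, diffFamily, bar_diff, neg_neg]

lemma diff_conv (f g : ℕ → ℕ → CochainAlg 𝕜 K) (i j : ℕ) :
    diff 𝕜 K (conv f g i j) =
      conv (diffFamily f) g i j - conv (barFamily f) (diffFamily g) i j := by
  simp only [conv, map_sum, diff_wedge, Finset.sum_sub_distrib, diffFamily, barFamily]

/-- If the equation `d c = c̄ c` holds at all proper subintervals of `[i, j]`, then `c̄ c` is a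
cocycle at `(i, j)`. -/
lemma diff_conv_bar_eq_zero {c : ℕ → ℕ → CochainAlg 𝕜 K} {i j : ℕ}
    (hc : ∀ p q, i ≤ p → p < q → q ≤ j → q - p < j - i →
      diff 𝕜 K (c p q) = conv (barFamily c) c p q) :
    diff 𝕜 K (conv (barFamily c) c i j) = 0 := by
  have h1 : conv (diffFamily (barFamily c)) c i j =
      conv (-barFamily (conv (barFamily c) c)) c i j := by
    rw [diffFamily_barFamily]
    refine conv_congr (fun p h1 h2 => ?_) fun _ _ _ => rfl
    simp only [Pi.neg_apply, barFamily, diffFamily]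
    rw [hc i p le_rfl h1 h2.le (by omega)]
  have h2 : conv (barFamily (barFamily c)) (diffFamily c) i j =
      conv (barFamily (barFamily c)) (conv (barFamily c) c) i j :=
    conv_congr (fun _ _ _ => rfl) fun p h1 h2 => hc p j h1.le h2 le_rfl (by omega)
  -- Both terms become c c̄ c: the sign from d(c̄) = -bar(dc) cancels the one from bar(c̄c) = -c c̄.
  rw [diff_conv, h1, h2, barFamily_conv, neg_neg, barFamily_barFamily, conv_assoc, sub_self]

/-- If `b` satisfies `d b = c' - c + c b + b̄ c'` at all proper subintervals of `[i, j]`, then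
`c b + b̄ c'` is at `(i, j)` a primitive of `c̄ c - c̄' c'`. -/
lemma diff_gauge {c c' b : ℕ → ℕ → CochainAlg 𝕜 K} {i j : ℕ}
    (hc : ∀ p q, i ≤ p → p < q → q ≤ j → q - p < j - i →
      diff 𝕜 K (c p q) = conv (barFamily c) c p q)
    (hc' : ∀ p q, i ≤ p → p < q → q ≤ j → q - p < j - i →
      diff 𝕜 K (c' p q) = conv (barFamily c') c' p q)
    (hb : ∀ p q, i ≤ p → p < q → q ≤ j → q - p < j - i →
      diff 𝕜 K (b p q) = (c' - c + conv c b + conv (barFamily b) c') p q) :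
    diff 𝕜 K ((conv c b + conv (barFamily b) c') i j) =
      conv (barFamily c) c i j - conv (barFamily c') c' i j := by
  have h1 : conv (diffFamily c) b i j = conv (conv (barFamily c) c) b i j :=
    conv_congr (fun p h1 h2 => hc i p le_rfl h1 h2.le (by omega)) fun _ _ _ => rfl
  have h2 : conv (barFamily c) (diffFamily b) i j =
      conv (barFamily c) (c' - c + conv c b + conv (barFamily b) c') i j :=
    conv_congr (fun _ _ _ => rfl) fun p h1 h2 => hb p j h1.le h2 le_rfl (by omega)
  have h3 : conv (diffFamily (barFamily b)) c' i j =
      conv (-barFamily (c' - c + conv c b + conv (barFamily b) c')) c' i j := by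
    rw [diffFamily_barFamily]
    refine conv_congr (fun p h1 h2 => ?_) fun _ _ _ => rfl
    simp only [Pi.neg_apply, barFamily, diffFamily]
    rw [hb i p le_rfl h1 h2.le (by omega)]
  have h4 : conv (barFamily (barFamily b)) (diffFamily c') i j =
      conv (barFamily (barFamily b)) (conv (barFamily c') c') i j :=
    conv_congr (fun _ _ _ => rfl) fun p h1 h2 => hc' p j h1.le h2 le_rfl (by omega)
  -- In matrix form, d(cb) = c̄cb - c̄(c' - c + cb + b̄c') and d(b̄c') = -(c̄' - c̄ - c̄b̄ - bc̄')c'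
  -- - bc̄'c'; everything cancels except c̄c - c̄'c'.
  simp only [Pi.add_apply, map_add, diff_conv]
  rw [h1, h2, h3, h4]
  simp only [barFamily_add, barFamily_sub, barFamily_conv, barFamily_barFamily, conv_neg_left,
    conv_add_left, conv_sub_left, conv_add_right, conv_sub_right, conv_assoc, Pi.add_apply,
    Pi.sub_apply, Pi.neg_apply]
  abel

/-- A family indexed by pairs `i < j` can be constructed by recursion on `j - i`. -/
lemma exists_family {A : Type*} [Nonempty A] (Q : (ℕ → ℕ → A) → ℕ → ℕ → A → Prop)
    (hloc : ∀ c c' i j x, (∀ p q, i ≤ p → p < q → q ≤ j → q - p < j - i → c p q = c' p q) →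
      Q c i j x → Q c' i j x)
    (hex : ∀ c i j, i < j → (∀ p q, i ≤ p → p < q → q ≤ j → q - p < j - i → Q c p q (c p q)) →
      ∃ x, Q c i j x) (n : ℕ) :
    ∃ c : ℕ → ℕ → A, ∀ i j, i < j → j - i ≤ n → Q c i j (c i j) := by
  classical
  induction n with
  | zero => exact ⟨fun _ _ => Classical.arbitrary A, fun i j h h' => by omega⟩
  | succ n ih =>
    obtain ⟨c, hc⟩ := ih
    have hx : ∀ i j, ∃ x, i < j → j - i = n + 1 → Q c i j x := fun i j => by
      by_cases h : i < j ∧ j - i = n + 1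
      · obtain ⟨x, hx⟩ := hex c i j h.1 fun p q _ h2 _ h4 => hc p q h2 (by omega)
        exact ⟨x, fun _ _ => hx⟩
      · exact ⟨Classical.arbitrary A, fun h1 h2 => absurd ⟨h1, h2⟩ h⟩
    choose e he using hx
    -- Entries on short intervals are kept, so `hloc` carries `Q` over to the modified family.
    refine ⟨fun i j => if j - i ≤ n then c i j else e i j, fun i j hij hn => ?_⟩
    refine hloc c _ i j _ (fun p q _ _ _ h4 => (if_pos (by omega)).symm) ?_
    by_cases h : j - i ≤ n
    · simpa only [if_pos h] using hc i j hij h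
    · simpa only [if_neg h] using he i j hij (by omega)

end Families

/-! ### Blocks, degrees and Massey products. -/

section Massey

variable {𝕜 : Type*} [CommRing 𝕜] {m : ℕ} {K : LowerSet (Finset (Fin m))}
  {I : ℕ → Finset (Fin m)} {d : ℕ → ℤ} {k : ℕ}

lemma mem_coboundaries_of_subsingleton {J : Finset (Fin m)} {n : ℤ}
    (h : Subsingleton (RedCohomology 𝕜 K J n)) {x : CochainAlg 𝕜 K}
    (hx : x ∈ cocycles 𝕜 K J n) : x ∈ coboundaries 𝕜 K J n := by
  have : (Submodule.Quotient.mk ⟨x, hx⟩ : RedCohomology 𝕜 K J n) = 0 := Subsingleton.elim _ _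
  have h := (Submodule.Quotient.mk_eq_zero _).1 this
  exact h

lemma sub_mem_coboundaries {J : Finset (Fin m)} {n : ℤ} {x y : CochainAlg 𝕜 K}
    {α : RedCohomology 𝕜 K J n} (hx : Represents x α) (hy : Represents y α) :
    x - y ∈ coboundaries 𝕜 K J n := by
  obtain ⟨h1, rfl⟩ := hx
  obtain ⟨h2, h⟩ := hy
  have h := (Submodule.Quotient.eq _).1 h.symm
  exact h

lemma block_union {s t u : ℕ} (h1 : s ≤ t + 1) (h2 : t ≤ u) :
    block I s t ∪ block I (t + 1) u = block I s u := by
  unfold block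
  rw [← Finset.union_biUnion]
  congr 1
  ext a
  simp only [Finset.mem_union, Finset.mem_Icc]
  omega

/-- Each `blockDeg` carries its own `+ 1`, so splitting a block leaves a surplus of one. -/
lemma blockDeg_add {s t u : ℕ} (h1 : s ≤ t + 1) (h2 : t ≤ u) :
    blockDeg d s t + blockDeg d (t + 1) u = blockDeg d s u + 1 := by
  unfold blockDeg
  have : Finset.Icc s u = Finset.Icc s t ∪ Finset.Icc (t + 1) u := by
    ext a
    simp only [Finset.mem_union, Finset.mem_Icc]
    omega
  rw [this, Finset.sum_union]
  · ring
  · refine Finset.disjoint_left.2 fun a ha hb => ?_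
    simp only [Finset.mem_Icc] at ha hb
    omega

lemma block_self (s : ℕ) : block I s s = I s := by simp [block]

lemma blockDeg_self (s : ℕ) : blockDeg d s s = d s + 1 := by simp [blockDeg]

lemma card_block (hI : (Set.Icc 1 k).PairwiseDisjoint I) {s t : ℕ} (hs : 1 ≤ s) (ht : t ≤ k) :
    (block I s t).card = ∑ r ∈ Finset.Icc s t, (I r).card := by
  refine Finset.card_biUnion fun a ha b hb hab => hI ?_ ?_ hab
  · exact ⟨hs.trans (Finset.mem_Icc.1 ha).1, (Finset.mem_Icc.1 ha).2.trans ht⟩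
  · exact ⟨hs.trans (Finset.mem_Icc.1 hb).1, (Finset.mem_Icc.1 hb).2.trans ht⟩

/-- With `card_block`, where disjointness of the I_j enters, this yields the total degree condition
of a defining system from the multigrading. -/
lemma cochains_le_homogeneous (J : Finset (Fin m)) (n : ℤ) :
    cochains 𝕜 K J n ≤ homogeneous 𝕜 K (n + 1 + J.card) := by
  intro x hx p hp
  obtain ⟨h1, h2⟩ := hx p hp
  rw [h1]
  push_cast
  rw [h2]
  ring

/-- The product of two families of cochains on the blocks, of degrees `d(s, t) - a` and
`d(s, t) - b`. -/
lemma conv_mem_cochains {f g : ℕ → ℕ → CochainAlg 𝕜 K} {a b n : ℤ} {s t : ℕ}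
    (hn : n = blockDeg d s t + 2 - a - b)
    (hf : ∀ p, s ≤ p → p < t → f s (p + 1) ∈ cochains 𝕜 K (block I s p) (blockDeg d s p - a))
    (hg : ∀ p, s ≤ p → p < t →
      g (p + 1) (t + 1) ∈ cochains 𝕜 K (block I (p + 1) t) (blockDeg d (p + 1) t - b)) :
    conv f g s (t + 1) ∈ cochains 𝕜 K (block I s t) n := by
  refine Submodule.sum_mem _ fun p hp => ?_
  obtain ⟨h1, h2⟩ := Finset.mem_Ioo.1 hp
  obtain ⟨q, rfl⟩ : ∃ q, p = q + 1 := ⟨p - 1, by omega⟩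
  have := wedge_mem_cochains (hf q (by omega) (by omega)) (hg q (by omega) (by omega))
  rw [block_union (by omega) (by omega)] at this
  have e := blockDeg_add (d := d) (s := s) (t := q) (u := t) (by omega) (by omega)
  rwa [show n = blockDeg d s q - a + (blockDeg d (q + 1) t - b) + 1 by linarith]

lemma IsDefiningSystem.diff_apply {α : ∀ j, RedCohomology 𝕜 K (I j) (d j)}
    {c : ℕ → ℕ → CochainAlg 𝕜 K} (h : IsDefiningSystem k α c) {i j : ℕ} (hi : 1 ≤ i) (hij : i < j)
    (hj : j ≤ k + 1) (hlt : j - i < k) : diff 𝕜 K (c i j) = conv (barFamily c) c i j :=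
  h.diff_eq i j hi hij hj fun e => by
    obtain ⟨rfl, rfl⟩ := Prod.mk.inj e
    omega

lemma relatedCochain_eq (c : ℕ → ℕ → CochainAlg 𝕜 K) :
    relatedCochain k c = -conv (barFamily c) c 1 (k + 1) := by
  unfold relatedCochain conv barFamily
  congr 1
  refine Finset.sum_bij' (fun j _ => 1 + j) (fun p _ => p - 1) ?_ ?_ ?_ ?_ ?_
  all_goals intro a ha
  all_goals simp only [Finset.mem_Icc, Finset.mem_Ioo] at ha ⊢
  all_goals omega

lemma relatedCochain_mem_cocycles {α : ∀ j, RedCohomology 𝕜 K (I j) (d j)}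
    {c : ℕ → ℕ → CochainAlg 𝕜 K} (h : IsMultigradedDefiningSystem k α c) :
    relatedCochain k c ∈ cocycles 𝕜 K (block I 1 k) (blockDeg d 1 k) := by
  rw [relatedCochain_eq]
  refine Submodule.neg_mem _ (Submodule.mem_inf.2 ⟨?_, ?_⟩)
  · exact conv_mem_cochains (f := barFamily c) (g := c) (I := I) (d := d) (a := 1) (b := 1)
      (s := 1) (t := k) (by ring)
      (fun p h1 h2 => bar_mem_cochains (h.mem_cochains 1 p le_rfl h1 h2.le (by simp; omega)))
      (fun p h1 h2 => h.mem_cochains (p + 1) k (by omega) h2 le_rfl (by simp; omega))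
  · exact diff_conv_bar_eq_zero fun p q h1 h2 h3 h4 =>
      h.toIsDefiningSystem.diff_apply h1 h2 h3 (by omega)

/-- The Massey product is defined if the obstruction groups vanish. -/
lemma masseyDefined_of_subsingleton (hk : 2 ≤ k) (hI : (Set.Icc 1 k).PairwiseDisjoint I)
    (α : ∀ j, RedCohomology 𝕜 K (I j) (d j))
    (hvan : ∀ s t, 1 ≤ s → s < t → t ≤ k → t - s + 1 < k →
      Subsingleton (RedCohomology 𝕜 K (block I s t) (blockDeg d s t))) :
    MasseyDefined k α := by
  obtain ⟨c, hc⟩ := exists_family (A := CochainAlg 𝕜 K)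
    -- The bound `j - i < k` leaves out the corner, where no equation is imposed.
    (fun c i j x => 1 ≤ i → j ≤ k + 1 → j - i < k →
      x ∈ cochains 𝕜 K (block I i (j - 1)) (blockDeg d i (j - 1) - 1) ∧
      diff 𝕜 K x = conv (barFamily c) c i j ∧ (j = i + 1 → Represents x (α i)))
    (by
      intro c c' i j x hcc h hi hj hk
      obtain ⟨h1, h2, h3⟩ := h hi hj hk
      refine ⟨h1, h2.trans (conv_congr (fun p hp hp' => ?_) fun p hp hp' => ?_), h3⟩
      · simp only [barFamily]
        rw [hcc i p le_rfl hp hp'.le (by omega)]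
      · exact hcc p j hp.le hp' le_rfl (by omega))
    (by
      intro c i j hij hc
      by_cases hr : 1 ≤ i ∧ j ≤ k + 1 ∧ j - i < k
      swap
      · exact ⟨0, fun h1 h2 h3 => absurd ⟨h1, h2, h3⟩ hr⟩
      obtain ⟨hi, hj, hk⟩ := hr
      obtain ⟨t, rfl⟩ : ∃ t, j = t + 1 := ⟨j - 1, by omega⟩
      rcases (show i ≤ t by omega).eq_or_lt with rfl | hit
      · obtain ⟨⟨x, hx⟩, hxα⟩ := Submodule.Quotient.mk_surjective _ (α i)
        refine ⟨x, fun _ _ _ => ⟨?_, ?_, fun _ => ⟨hx, hxα⟩⟩⟩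
        · simpa [block_self, blockDeg_self] using hx.1
        · rw [show diff 𝕜 K x = 0 from hx.2]
          exact (conv_succ _ _ _).symm
      -- The obstruction to filling this entry is a cocycle in the degree where cohomology vanishes.
      · have hmem : conv (barFamily c) c i (t + 1) ∈
            cocycles 𝕜 K (block I i t) (blockDeg d i t) := by
          refine Submodule.mem_inf.2 ⟨?_, ?_⟩
          · exact conv_mem_cochains (f := barFamily c) (g := c) (I := I) (d := d) (a := 1) (b := 1)
              (s := i) (t := t) (by ring)
              (fun p h1 h2 => bar_mem_cochains
                (hc i (p + 1) le_rfl (by omega) (by omega) (by omega) hi (by omega) (by omega)).1)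
              (fun p h1 h2 => (hc (p + 1) (t + 1) (by omega) (by omega) le_rfl (by omega)
                (by omega) hj (by omega)).1)
          · exact diff_conv_bar_eq_zero fun p q h1 h2 h3 h4 =>
              (hc p q h1 h2 h3 h4 (by omega) (by omega) (by omega)).2.1
        obtain ⟨x, hx, hdx⟩ := mem_coboundaries_of_subsingleton
          (hvan i t hi hit (by omega) (by omega)) hmem
        exact ⟨x, fun _ _ _ => ⟨hx, hdx, fun h => by omega⟩⟩)
    k
  have hcoch : ∀ s t, 1 ≤ s → s ≤ t → t ≤ k → (s, t) ≠ (1, k) →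
      c s (t + 1) ∈ cochains 𝕜 K (block I s t) (blockDeg d s t - 1) := by
    intro s t hs hst ht hne
    have hlt : t + 1 - s < k := by
      by_contra h
      exact hne (Prod.ext (show s = 1 by omega) (show t = k by omega))
    exact (hc s (t + 1) (by omega) (by omega) hs (by omega) hlt).1
  refine ⟨c, ⟨⟨fun i h1 h2 => ?_, fun s t hs hst ht hne => ?_, fun i j hi hij hj hne => ?_⟩, hcoch⟩⟩
  · exact (hc i (i + 1) (by omega) (by omega) h1 (by omega) (by omega)).2.2 rfl
  · have := cochains_le_homogeneous _ _ (hcoch s t hs hst ht hne)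
    rw [card_block hI hs ht] at this
    have e : 1 + ∑ r ∈ Finset.Icc s t, ((d r + ((I r).card : ℤ) + 1) - 1) =
        blockDeg d s t - 1 + 1 + ((∑ r ∈ Finset.Icc s t, (I r).card : ℕ) : ℤ) := by
      simp only [blockDeg, Nat.cast_sum, add_sub_cancel_right, Finset.sum_add_distrib]
      ring
    rwa [e]
  · have hlt : j - i < k := by
      by_contra h
      exact hne (Prod.ext (show i = 1 by omega) (show j = k + 1 by omega))
    exact (hc i j hij hlt.le hi hj hlt).2.1

/-- The class of the related cocycle does not depend on the defining system if the groups in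
which two fillings differ vanish. -/
lemma relatedCochain_sub_mem_coboundaries {α : ∀ j, RedCohomology 𝕜 K (I j) (d j)}
    (hvan : ∀ s t, 1 ≤ s → s < t → t ≤ k → t - s + 1 < k →
      Subsingleton (RedCohomology 𝕜 K (block I s t) (blockDeg d s t - 1)))
    {c c' : ℕ → ℕ → CochainAlg 𝕜 K} (hc : IsMultigradedDefiningSystem k α c)
    (hc' : IsMultigradedDefiningSystem k α c') :
    relatedCochain k c' - relatedCochain k c ∈
      coboundaries 𝕜 K (block I 1 k) (blockDeg d 1 k) := by
  have hmem : ∀ {c : ℕ → ℕ → CochainAlg 𝕜 K}, IsMultigradedDefiningSystem k α c →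
      ∀ s t, 1 ≤ s → s ≤ t → t ≤ k → t + 1 - s < k →
      c s (t + 1) ∈ cochains 𝕜 K (block I s t) (blockDeg d s t - 1) :=
    fun h s t h1 h2 h3 h4 => h.mem_cochains s t h1 h2 h3 fun e => by
      obtain ⟨rfl, rfl⟩ := Prod.mk.inj e
      omega
  -- Entries of b lie one degree below those of c. The corner is included here, since it needs only
  -- proper entries of b.
  have hgauge : ∀ (b : ℕ → ℕ → CochainAlg 𝕜 K) (s t : ℕ), 1 ≤ s → t ≤ k →
      (∀ p q, s ≤ p → p < q → q ≤ t + 1 → q - p < t + 1 - s →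
        b p q ∈ cochains 𝕜 K (block I p (q - 1)) (blockDeg d p (q - 1) - 2)) →
      (conv c b + conv (barFamily b) c') s (t + 1) ∈
        cochains 𝕜 K (block I s t) (blockDeg d s t - 1) := by
    intro b s t hs ht hb
    refine Submodule.add_mem _ ?_ ?_
    · exact conv_mem_cochains (f := c) (g := b) (I := I) (d := d) (a := 1) (b := 2)
        (s := s) (t := t) (by ring)
        (fun p h1 h2 => hmem hc s p hs h1 (by omega) (by omega))
        (fun p h1 h2 => hb (p + 1) (t + 1) (by omega) (by omega) le_rfl (by omega))
    · exact conv_mem_cochains (f := barFamily b) (g := c') (I := I) (d := d) (a := 2) (b := 1)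
        (s := s) (t := t) (by ring)
        (fun p h1 h2 => bar_mem_cochains (hb s (p + 1) le_rfl (by omega) (by omega) (by omega)))
        (fun p h1 h2 => hmem hc' (p + 1) t (by omega) (by omega) ht (by omega))
  obtain ⟨b, hb⟩ := exists_family (A := CochainAlg 𝕜 K)
    (fun b i j x => 1 ≤ i → j ≤ k + 1 → j - i < k →
      x ∈ cochains 𝕜 K (block I i (j - 1)) (blockDeg d i (j - 1) - 2) ∧
      diff 𝕜 K x = (c' - c + conv c b + conv (barFamily b) c') i j)
    (by
      intro b b' i j x hbb h hi hj hk
      obtain ⟨h1, h2⟩ := h hi hj hk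
      refine ⟨h1, h2.trans ?_⟩
      simp only [Pi.add_apply]
      congr 1
      · congr 1
        exact conv_congr (fun _ _ _ => rfl) fun p hp hp' => hbb p j hp.le hp' le_rfl (by omega)
      · refine conv_congr (fun p hp hp' => ?_) fun _ _ _ => rfl
        simp only [barFamily]
        rw [hbb i p le_rfl hp hp'.le (by omega)])
    (by
      intro b i j hij hb
      by_cases hr : 1 ≤ i ∧ j ≤ k + 1 ∧ j - i < k
      swap
      · exact ⟨0, fun h1 h2 h3 => absurd ⟨h1, h2, h3⟩ hr⟩
      obtain ⟨hi, hj, hk⟩ := hr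
      obtain ⟨t, rfl⟩ : ∃ t, j = t + 1 := ⟨j - 1, by omega⟩
      have hcob : (c' - c + conv c b + conv (barFamily b) c') i (t + 1) ∈
          coboundaries 𝕜 K (block I i t) (blockDeg d i t - 1) := by
        -- On a single block the gauge terms are empty sums, leaving the difference of two
        -- representatives of one class.
        rcases (show i ≤ t by omega).eq_or_lt with rfl | hit
        · have := sub_mem_coboundaries (hc'.represents i hi (by omega))
            (hc.represents i hi (by omega))
          simpa [block_self, blockDeg_self, conv_succ] using this
        · refine mem_coboundaries_of_subsingleton (hvan i t hi hit (by omega) (by omega))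
            (Submodule.mem_inf.2 ⟨?_, ?_⟩)
          · rw [add_assoc]
            exact Submodule.add_mem _
              (Submodule.sub_mem _ (hmem hc' i t hi hit.le (by omega) hk)
                (hmem hc i t hi hit.le (by omega) hk))
              (hgauge b i t hi (by omega) fun p q h1 h2 h3 h4 =>
                (hb p q h1 h2 h3 h4 (by omega) (by omega) (by omega)).1)
          -- The coboundary of the gauge terms is opposite to that of c' - c, so the sum is closed.
          · have := diff_gauge (c := c) (c' := c') (b := b) (i := i) (j := t + 1)
              (fun p q h1 h2 h3 h4 =>
                hc.toIsDefiningSystem.diff_apply (by omega) h2 (by omega) (by omega))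
              (fun p q h1 h2 h3 h4 =>
                hc'.toIsDefiningSystem.diff_apply (by omega) h2 (by omega) (by omega))
              (fun p q h1 h2 h3 h4 =>
                (hb p q h1 h2 h3 h4 (by omega) (by omega) (by omega)).2)
            rw [LinearMap.mem_ker, add_assoc, Pi.add_apply, Pi.add_apply, map_add, this,
              Pi.sub_apply, Pi.sub_apply, map_sub,
              hc.toIsDefiningSystem.diff_apply hi hij hj hk,
              hc'.toIsDefiningSystem.diff_apply hi hij hj hk]
            abel
      obtain ⟨x, hx, hdx⟩ := hcob
      refine ⟨x, fun _ _ _ => ⟨?_, hdx⟩⟩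
      rwa [Nat.add_sub_cancel, show blockDeg d i t - 2 = blockDeg d i t - 1 - 1 by ring])
    k
  rw [relatedCochain_eq, relatedCochain_eq]
  -- At the corner the gauge terms themselves are the primitive of a(C') - a(C).
  refine ⟨(conv c b + conv (barFamily b) c') 1 (k + 1),
    hgauge b 1 k le_rfl le_rfl fun p q h1 h2 h3 h4 =>
      (hb p q h2 (by omega) h1 h3 (by omega)).1, ?_⟩
  rw [diff_gauge
    (fun p q h1 h2 h3 h4 => hc.toIsDefiningSystem.diff_apply h1 h2 h3 (by omega))
    (fun p q h1 h2 h3 h4 => hc'.toIsDefiningSystem.diff_apply h1 h2 h3 (by omega))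
    (fun p q h1 h2 h3 h4 => (hb p q h2 (by omega) h1 h3 (by omega)).2)]
  abel

lemma masseyProduct_eq_singleton {α : ∀ j, RedCohomology 𝕜 K (I j) (d j)}
    (hvan : ∀ s t, 1 ≤ s → s < t → t ≤ k → t - s + 1 < k →
      Subsingleton (RedCohomology 𝕜 K (block I s t) (blockDeg d s t - 1)))
    {c : ℕ → ℕ → CochainAlg 𝕜 K} (hc : IsMultigradedDefiningSystem k α c) :
    masseyProduct k α =
      {Submodule.Quotient.mk ⟨relatedCochain k c, relatedCochain_mem_cocycles hc⟩} := by
  ext x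
  constructor
  · rintro ⟨c', hc', h', rfl⟩
    exact (Submodule.Quotient.eq _).2 (relatedCochain_sub_mem_coboundaries hvan hc hc')
  · rintro rfl
    exact ⟨c, hc, relatedCochain_mem_cocycles hc, rfl⟩

end Massey

end MomentAngle

/-! ### The theorem, with r = t - s translating between the two indexings of blocks. -/

theorem mainTheorem1 {𝕜 : Type*} [CommRing 𝕜] {m : ℕ} (K : LowerSet (Finset (Fin m)))
    (k : ℕ) (hk : 3 ≤ k)
    (I : ℕ → Finset (Fin m)) (hI : (Set.Icc 1 k).PairwiseDisjoint I)
    (d : ℕ → ℤ) (hd : ∀ j ∈ Set.Icc 1 k, 0 ≤ d j)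
    (α : ∀ j, MomentAngle.RedCohomology 𝕜 K (I j) (d j)) :
    ((∀ r s : ℕ, 1 ≤ r → r ≤ k - 2 → 1 ≤ s → s ≤ k - r →
        Subsingleton (MomentAngle.RedCohomology 𝕜 K (MomentAngle.block I s (r + s))
          (MomentAngle.blockDeg d s (r + s)))) →
      MomentAngle.MasseyDefined k α) ∧
    ((∀ r s : ℕ, 1 ≤ r → r ≤ k - 2 → 1 ≤ s → s ≤ k - r →
        Subsingleton (MomentAngle.RedCohomology 𝕜 K (MomentAngle.block I s (r + s))
          (MomentAngle.blockDeg d s (r + s) - 1))) →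
      MomentAngle.MasseyDefined k α →
      MomentAngle.MasseyStrictlyDefined k α ∧
      ∃ c : ℕ → ℕ → MomentAngle.CochainAlg 𝕜 K,
        MomentAngle.IsDefiningSystem k α c ∧
        (∀ r s : ℕ, 1 ≤ r → r ≤ k - 2 → 1 ≤ s → s ≤ k - r →
          c s (r + s + 1) ∈ MomentAngle.cochains 𝕜 K (MomentAngle.block I s (r + s))
            (MomentAngle.blockDeg d s (r + s) - 1)) ∧
        ∃ h : MomentAngle.relatedCochain k c ∈
            MomentAngle.cocycles 𝕜 K (MomentAngle.block I 1 k) (MomentAngle.blockDeg d 1 k),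
          MomentAngle.masseyProduct k α =
            {Submodule.Quotient.mk ⟨MomentAngle.relatedCochain k c, h⟩}) := by
  refine ⟨fun hvan => MomentAngle.masseyDefined_of_subsingleton (by omega) hI α
    fun s t hs hst ht hlt => ?_, fun hvan => ?_⟩
  · have := hvan (t - s) s (by omega) (by omega) hs (by omega)
    rwa [Nat.sub_add_cancel hst.le] at this
  · rintro ⟨c, hc⟩
    have heq := MomentAngle.masseyProduct_eq_singleton (fun s t hs hst ht hlt => by
      have := hvan (t - s) s (by omega) (by omega) hs (by omega)
      rwa [Nat.sub_add_cancel hst.le] at this) hc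
    refine ⟨⟨⟨c, hc⟩, _, heq⟩, c, hc.toIsDefiningSystem, fun r s hr hrk hs hsk => ?_,
      MomentAngle.relatedCochain_mem_cocycles hc, heq⟩
    exact hc.mem_cochains s (r + s) hs (by omega) (by omega) fun e => by
      obtain ⟨h1, h2⟩ := Prod.mk.inj e
      omega
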